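/- Let $0<q<1$, $0<a<q^{-1}$, $b<q^{-1}$ ($a,b$ real) and $v\in\mathbb{C}$. Put $$K=\begin{pmatrix}0&v(1-q)(q^{-1}-a)\\0&0\end{pmatrix},\qquad M=\begin{pmatrix}1&v\\0&0\end{pmatrix},\qquad A=e^{\log(q)M}=\begin{pmatrix}q&-v(1-q)\\0&1\end{pmatrix}.$$ For $x\in\mathbb{N}=\{0,1,2,\dots\}$ let $$W(q^x)=a^x\frac{(bq;q)_x}{(q;q)_x}A^x(A^*)^x,\qquad (c;q)_x=\prod_{k=0}^{x-1}(1-cq^k),$$ and for functions $P,Q$ on $\mathbb{C}$ with values in $\mathrm{Mat}_2(\mathbb{C})$ let $$\langle P,Q\rangle_W=\sum_{x=0}^{\infty}q^x\,P(q^x)\,W(q^x)\,Q(q^x)^*$$ whenever the series converges. Define the operator $D$ by $$(DP)(z)=P(q^{-1}z)(z^{-1}-1)A^{-1}+P(z)\bigl(K-z^{-1}(A^{-1}+aA)\bigr)+P(qz)(az^{-1}-abq)A,\qquad z\neq 0.$$ Then: 1. $W$ is a $q$-weight matrix: $W(q^x)$ is positive definite for every $x\in\mathbb{N}$, the moments $\sum_{x}q^x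 q^{kx}W(q^x)$ converge for all $k\in\mathbb{N}$, and $\langle P,P\rangle_W$ is non-singular for every matrix-valued polynomial $P$ with non-singular leading coefficient. 2. $D$ is symmetric with respect to $W$: it maps $\mathrm{Mat}_2(\mathbb{C})$-valued polynomials in $z$ to such polynomials, and $\langle DP,Q\rangle_W=\langle P,DQ\rangle_W$ for all matrix-valued polynomials $P,Q$. 3. There is a unique sequence $(P_n)_{n\ge0}$ of monic orthogonal polynomials with respect to $W$, i.e. $P_n$ is a matrix-valued polynomial of degree $n$ with leading coefficient $I$ and $\langle P_m,P_n\rangle_W=\delta_{m,n}\Gamma_m$ with $\Gamma_m$ positive definite; and for all $n\ge 0$ it satisfies $DP_n=\Lambda_nP_n$, where $$\Lambda_n=\begin{pmatrix}-q^{-n-1}-abq^{n+2}&v(1-q)\bigl(abq^{n+1}-q^{-1-n}+q^{-1}-a\bigr)\\0&-q^{-n}-abq^{n+1}\end{pmatrix}.$$ -/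

import Mathlib

open scoped ComplexOrder

noncomputable section

/-- The `q`-Pochhammer symbol `(a;q)_n = ∏_{k<n} (1 - a q^k)`. -/
def qPoch (a q : ℝ) : ℕ → ℝ
  | 0 => 1
  | n + 1 => (1 - a * q ^ n) * qPoch a q n

/-- `N × N` complex matrices. -/
abbrev CMat (N : ℕ) : Type := Matrix (Fin N) (Fin N) ℂ

/-- The value `P(z) = ∑ₖ zᵏ Pₖ` of a matrix-valued polynomial at a complex number `z`. -/
def polyVal {N : ℕ} (P : Polynomial (CMat N)) (z : ℂ) : CMat N :=
  P.sum fun k c => z ^ k • c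

/-- The `n`-th term `qⁿ f(qⁿ) W(qⁿ) g(qⁿ)^*` of the series defining the matrix-valued inner
product. A weight on the lattice `{qⁿ : n ∈ ℕ}` is given by the sequence `W n = W(qⁿ)`. -/
def qInnerTerm {N : ℕ} (q : ℝ) (W : ℕ → CMat N) (f g : ℂ → CMat N) (n : ℕ) : CMat N :=
  ((q : ℂ) ^ n) • (f ((q : ℂ) ^ n) * W n * (g ((q : ℂ) ^ n)).conjTranspose)

/-- `⟨f, g⟩_W = ∑ₙ qⁿ f(qⁿ) W(qⁿ) g(qⁿ)^*`. -/
def qInner {N : ℕ} (q : ℝ) (W : ℕ → CMat N) (f g : ℂ → CMat N) : CMat N :=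
  ∑' n, qInnerTerm q W f g n

/-- `W` is a `q`-weight matrix: positive definite at every lattice point, with finite moments of
every order, and nondegenerate. -/
structure IsQWeight {N : ℕ} (q : ℝ) (W : ℕ → CMat N) : Prop where
  posDef : ∀ n, (W n).PosDef
  moments : ∀ k : ℕ, Summable fun n : ℕ => ((q : ℂ) ^ n * ((q : ℂ) ^ n) ^ k) • W n
  nonsingular : ∀ P : Polynomial (CMat N), IsUnit P.leadingCoeff →
    IsUnit (qInner q W (polyVal P) (polyVal P))

/-- A sequence of orthogonal matrix-valued polynomials for the weight `W`. -/
structure IsOrthogonalSeq {N : ℕ} (q : ℝ) (W : ℕ → CMat N)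
    (P : ℕ → Polynomial (CMat N)) : Prop where
  natDegree_eq : ∀ n, (P n).natDegree = n
  isUnit_leadingCoeff : ∀ n, IsUnit (P n).leadingCoeff
  orthogonal : ∃ Γ : ℕ → CMat N, (∀ n, (Γ n).PosDef) ∧
    ∀ m n, qInner q W (polyVal (P m)) (polyVal (P n)) = if m = n then Γ m else 0

/-- A sequence of monic orthogonal matrix-valued polynomials for the weight `W`. -/
def IsMonicOrthogonalSeq {N : ℕ} (q : ℝ) (W : ℕ → CMat N)
    (P : ℕ → Polynomial (CMat N)) : Prop :=
  IsOrthogonalSeq q W P ∧ ∀ n, (P n).Monic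

/-- The `q`-shift `(E_ℓ f)(z) = f(q^ℓ z)`. -/
def qShift {N : ℕ} (q : ℝ) (l : ℤ) (f : ℂ → CMat N) : ℂ → CMat N :=
  fun z => f ((q : ℂ) ^ l * z)

/-- The operator `E_{-1} F_{-1} + E_0 F_0 + E_1 F_1`, with coefficients acting from the right.
The coefficients are polynomials in `z⁻¹`, so only its values at `z ≠ 0` are meaningful. -/
def qDiffOp {N : ℕ} (q : ℝ) (Fm F0 Fp : ℂ → CMat N) (f : ℂ → CMat N) : ℂ → CMat N :=
  fun z => qShift q (-1) f z * Fm z + qShift q 0 f z * F0 z + qShift q 1 f z * Fp z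

/-- `D` maps matrix-valued polynomials to matrix-valued polynomials (as functions of `z ≠ 0`) and
`⟨D P, Q⟩_W = ⟨P, D Q⟩_W` for all matrix-valued polynomials `P`, `Q`. All lattice points `qⁿ` are
nonzero, so the value of `D P` at `0` does not matter. -/
structure IsSymmetricOp {N : ℕ} (q : ℝ) (W : ℕ → CMat N)
    (D : (ℂ → CMat N) → (ℂ → CMat N)) : Prop where
  preserves : ∀ P : Polynomial (CMat N), ∃ R : Polynomial (CMat N),
    ∀ z : ℂ, z ≠ 0 → D (polyVal P) z = polyVal R z
  symm : ∀ P Q : Polynomial (CMat N),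
    qInner q W (D (polyVal P)) (polyVal Q) = qInner q W (polyVal P) (D (polyVal Q))

namespace LittleQJacobi

def matK (q a : ℝ) (v : ℂ) : CMat 2 :=
  !![0, v * (1 - (q : ℂ)) * ((q : ℂ)⁻¹ - (a : ℂ)); 0, 0]

def matM (v : ℂ) : CMat 2 := !![1, v; 0, 0]

def matA (q : ℝ) (v : ℂ) : CMat 2 := !![(q : ℂ), -v * (1 - (q : ℂ)); 0, 1]

/-- `F_{-1}(z) = (z⁻¹ - 1) A⁻¹`. -/
def coeffNegOne (q : ℝ) (v : ℂ) (z : ℂ) : CMat 2 := (z⁻¹ - 1) • (matA q v)⁻¹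

/-- `F_0(z) = K - z⁻¹ (A⁻¹ + a A)`. -/
def coeffZero (q a : ℝ) (v : ℂ) (z : ℂ) : CMat 2 :=
  matK q a v - z⁻¹ • ((matA q v)⁻¹ + (a : ℂ) • matA q v)

/-- `F_1(z) = (a z⁻¹ - a b q) A`. -/
def coeffOne (q a b : ℝ) (v : ℂ) (z : ℂ) : CMat 2 :=
  ((a : ℂ) * z⁻¹ - (a : ℂ) * (b : ℂ) * (q : ℂ)) • matA q v

/-- `D = E_{-1} F_{-1} + E_0 F_0 + E_1 F_1`. -/
def opD (q a b : ℝ) (v : ℂ) : (ℂ → CMat 2) → (ℂ → CMat 2) :=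
  qDiffOp q (coeffNegOne q v) (coeffZero q a v) (coeffOne q a b v)

/-- `W(q^x) = a^x (bq;q)_x / (q;q)_x · A^x (A^*)^x`. -/
def weight (q a b : ℝ) (v : ℂ) (x : ℕ) : CMat 2 :=
  ((a ^ x * (qPoch (b * q) q x / qPoch q q x) : ℝ) : ℂ) •
    ((matA q v) ^ x * (matA q v).conjTranspose ^ x)

/-- The eigenvalue matrix `Λ_n`. -/
def eigenvalue (q a b : ℝ) (v : ℂ) (n : ℕ) : CMat 2 :=
  !![-(q : ℂ) ^ (-(n : ℤ) - 1) - (a : ℂ) * b * (q : ℂ) ^ (n + 2),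
     v * (1 - (q : ℂ)) *
      ((a : ℂ) * b * (q : ℂ) ^ (n + 1) - (q : ℂ) ^ (-1 - (n : ℤ)) + (q : ℂ)⁻¹ - (a : ℂ));
     0,
     -(q : ℂ) ^ (-(n : ℤ)) - (a : ℂ) * b * (q : ℂ) ^ (n + 1)]

end LittleQJacobi

end

noncomputable section

/-! ### Matrix weights on the lattice `qⁿ`: positivity, monic orthogonal polynomials, eigenfunctions
of symmetric operators. -/

section GeneralWeight

variable {N : ℕ} {q : ℝ} {W : ℕ → CMat N}

/-! ### Values of matrix-valued polynomials -/

/-! The analytic heart is the symmetry of `D`. Write `β_n` for `boundaryCoeff q a b n`. The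
Pearson-type recurrence `scalarWeight_succ` makes `q^(n+1) F_{-1}(q^(n+1)) W(q^(n+1)) = β_n A^n
(A^(n+1))^*` the adjoint of `q^n F_1(q^n) W(q^n)`, while `q^n F_0(q^n) W(q^n)` is Hermitian and
`F_{-1}(1) = 0`. Hence the partial sums of `⟨DP,Q⟩ - ⟨P,DQ⟩` telescope to one boundary term
(`sum_qInnerTerm_opD_sub`). Its scalar `β_n` need not tend to zero, since `a ≥ 1` is allowed; but
the matrix bracket is `O(q^n)`, because consecutive values of `P`, `Q` and `A^n` differ by `O(q^n)`,
and `q^n β_n → 0` (`tendsto_boundaryTerm`).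

The rest is algebra and positivity. `D` does not raise degrees and multiplies the coefficient of
`z^n` on the right by `Λ_n` (`exists_opD_eq_polyVal`). So `DP_n - Λ_n P_n` has degree below `n`; by
symmetry it is orthogonal to all lower powers, hence to itself, and definiteness makes it zero
(`IsMonicOrthogonalSeq.eigenfunction`). Definiteness (`qInner_self_nonneg_or`) holds because a
polynomial vanishing on the infinite lattice is zero; it also gives nonsingularity of the form and
existence and uniqueness of the `P_n`. -/

lemma polyVal_eq_eval (P : Polynomial (CMat N)) (z : ℂ) :
    polyVal P z = P.eval (algebraMap ℂ (CMat N) z) := by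
  simp only [polyVal, Polynomial.eval_eq_sum, ← map_pow, ← Algebra.commutes, ← Algebra.smul_def]

lemma polyVal_zero (z : ℂ) : polyVal (0 : Polynomial (CMat N)) z = 0 := by
  simp [polyVal_eq_eval]

lemma polyVal_add (P Q : Polynomial (CMat N)) (z : ℂ) :
    polyVal (P + Q) z = polyVal P z + polyVal Q z := by
  simp [polyVal_eq_eval]

lemma polyVal_C_mul (c : CMat N) (P : Polynomial (CMat N)) (z : ℂ) :
    polyVal (Polynomial.C c * P) z = c * polyVal P z := by
  rw [polyVal_eq_eval, Polynomial.eval_C_mul, polyVal_eq_eval]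

lemma polyVal_monomial (k : ℕ) (c : CMat N) (z : ℂ) :
    polyVal (Polynomial.monomial k c) z = z ^ k • c := by
  rw [polyVal, Polynomial.sum_monomial_index _ _ (by simp)]

lemma continuous_polyVal (P : Polynomial (CMat N)) : Continuous (polyVal P) := by
  unfold polyVal Polynomial.sum
  fun_prop

/-- A matrix-valued polynomial with `x⋆ P(z) = 0` at infinitely many `z` satisfies
`x⋆ Pₖ = 0` for every coefficient `Pₖ`. -/
lemma vecMul_coeff_eq_zero (P : Polynomial (CMat N)) (x : Fin N → ℂ) {S : Set ℂ}
    (hS : S.Infinite) (h : ∀ z ∈ S, Matrix.vecMul x (polyVal P z) = 0) (k : ℕ) :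
    Matrix.vecMul x (P.coeff k) = 0 := by
  funext i
  let L : CMat N →+ ℂ := AddMonoidHom.mk' (fun A => Matrix.vecMul x A i)
    (fun A B => by simp [Matrix.vecMul_add])
  have hL : ∀ (z : ℂ) (A : CMat N), L (z • A) = z * L A := fun z A => by
    simp [L, Matrix.vecMul_smul]
  -- Entry `i` of `x P(z)` is a scalar polynomial in `z`, so having infinitely many roots kills it.
  let p : Polynomial ℂ := P.sum fun k c => Polynomial.monomial k (L c)
  have hev : ∀ z, p.eval z = L (polyVal P z) := fun z => by
    simp only [p, polyVal, Polynomial.sum, Polynomial.eval_finsetSum, Polynomial.eval_monomial,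
      map_sum, hL, mul_comm]
  have hp : p = 0 := by
    refine Polynomial.eq_zero_of_infinite_isRoot p (hS.mono fun z hz => ?_)
    change p.eval z = 0
    rw [hev]
    exact congrFun (h z hz) i
  have hc : p.coeff k = L (P.coeff k) := by
    simp only [p, Polynomial.sum, Polynomial.finsetSum_coeff, Polynomial.coeff_monomial]
    rw [Finset.sum_ite_eq']
    split_ifs with hk
    · rfl
    · rw [Polynomial.notMem_support_iff.mp hk, map_zero]
  rw [hp, Polynomial.coeff_zero] at hc
  exact hc.symm

lemma infinite_range_pow (hq0 : 0 < q) (hq1 : q < 1) :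
    (Set.range fun n : ℕ => (q : ℂ) ^ n).Infinite := by
  refine Set.infinite_range_of_injective fun m n h => ?_
  refine (pow_right_strictAnti₀ hq0 hq1).injective ?_
  exact_mod_cast (show (q : ℂ) ^ m = (q : ℂ) ^ n from h)

/-! ### The sesquilinear form -/

lemma summable_qInnerTerm
    (hm : ∀ k : ℕ, Summable fun n : ℕ => ((q : ℂ) ^ n * ((q : ℂ) ^ n) ^ k) • W n)
    (P Q : Polynomial (CMat N)) : Summable (qInnerTerm q W (polyVal P) (polyVal Q)) := by
  induction P using Polynomial.induction_on' with
  | add P₁ P₂ h₁ h₂ =>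
    refine (h₁.add h₂).congr fun n => ?_
    simp [qInnerTerm, polyVal_add, add_mul, smul_add]
  | monomial k c =>
    induction Q using Polynomial.induction_on' with
    | add Q₁ Q₂ h₁ h₂ =>
      refine (h₁.add h₂).congr fun n => ?_
      simp [qInnerTerm, polyVal_add, mul_add, smul_add]
    | monomial l d =>
      refine (((hm (k + l)).mul_left c).mul_right d.conjTranspose).congr fun n => ?_
      simp only [qInnerTerm, polyVal_monomial, Matrix.conjTranspose_smul, smul_mul_assoc,
        mul_smul_comm, smul_smul, map_pow, RCLike.star_def, Complex.conj_ofReal]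
      congr 1
      ring

lemma qInnerTerm_conjTranspose (hW : ∀ n, (W n).IsHermitian) (f g : ℂ → CMat N) (n : ℕ) :
    (qInnerTerm q W f g n).conjTranspose = qInnerTerm q W g f n := by
  simp only [qInnerTerm, Matrix.conjTranspose_smul, Matrix.conjTranspose_mul,
    Matrix.conjTranspose_conjTranspose, (hW n).eq, mul_assoc, map_pow, RCLike.star_def,
    Complex.conj_ofReal]

lemma qInner_conjTranspose (hW : ∀ n, (W n).IsHermitian) (f g : ℂ → CMat N) :
    (qInner q W f g).conjTranspose = qInner q W g f := by
  rw [qInner, Matrix.conjTranspose_tsum]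
  simp only [qInnerTerm_conjTranspose hW, qInner]

/-- The form depends only on the values on the lattice `{qⁿ}`. -/
lemma qInner_congr {f f' g g' : ℂ → CMat N}
    (hf : ∀ n : ℕ, f ((q : ℂ) ^ n) = f' ((q : ℂ) ^ n))
    (hg : ∀ n : ℕ, g ((q : ℂ) ^ n) = g' ((q : ℂ) ^ n)) :
    qInner q W f g = qInner q W f' g' := by
  simp only [qInner, qInnerTerm, hf, hg]

section Moments

variable (hm : ∀ k : ℕ, Summable fun n : ℕ => ((q : ℂ) ^ n * ((q : ℂ) ^ n) ^ k) • W n)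

include hm

lemma qInner_add_left (P₁ P₂ Q : Polynomial (CMat N)) :
    qInner q W (polyVal (P₁ + P₂)) (polyVal Q) =
      qInner q W (polyVal P₁) (polyVal Q) + qInner q W (polyVal P₂) (polyVal Q) := by
  rw [qInner, qInner, qInner,
    ← (summable_qInnerTerm hm P₁ Q).tsum_add (summable_qInnerTerm hm P₂ Q)]
  simp [qInnerTerm, polyVal_add, add_mul, smul_add]

lemma qInner_add_right (P Q₁ Q₂ : Polynomial (CMat N)) :
    qInner q W (polyVal P) (polyVal (Q₁ + Q₂)) =
      qInner q W (polyVal P) (polyVal Q₁) + qInner q W (polyVal P) (polyVal Q₂) := by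
  rw [qInner, qInner, qInner,
    ← (summable_qInnerTerm hm P Q₁).tsum_add (summable_qInnerTerm hm P Q₂)]
  simp [qInnerTerm, polyVal_add, mul_add, smul_add]

lemma qInner_C_mul_left (c : CMat N) (P Q : Polynomial (CMat N)) :
    qInner q W (polyVal (Polynomial.C c * P)) (polyVal Q) =
      c * qInner q W (polyVal P) (polyVal Q) := by
  rw [qInner, qInner, ← (summable_qInnerTerm hm P Q).tsum_mul_left]
  simp [qInnerTerm, polyVal_C_mul, mul_assoc]

lemma qInner_C_mul_right (c : CMat N) (P Q : Polynomial (CMat N)) :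
    qInner q W (polyVal P) (polyVal (Polynomial.C c * Q)) =
      qInner q W (polyVal P) (polyVal Q) * c.conjTranspose := by
  rw [qInner, qInner, ← (summable_qInnerTerm hm P Q).tsum_mul_right]
  simp [qInnerTerm, polyVal_C_mul, mul_assoc]

lemma qInner_sub_left (P₁ P₂ Q : Polynomial (CMat N)) :
    qInner q W (polyVal (P₁ - P₂)) (polyVal Q) =
      qInner q W (polyVal P₁) (polyVal Q) - qInner q W (polyVal P₂) (polyVal Q) := by
  rw [eq_sub_iff_add_eq, ← qInner_add_left hm, sub_add_cancel]

lemma hasSum_dotProduct_qInner_self (P : Polynomial (CMat N)) (x : Fin N → ℂ) :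
    HasSum (fun n : ℕ => (q : ℂ) ^ n *
      (star (Matrix.mulVec (polyVal P ((q : ℂ) ^ n)).conjTranspose x) ⬝ᵥ
        Matrix.mulVec (W n) (Matrix.mulVec (polyVal P ((q : ℂ) ^ n)).conjTranspose x)))
      (star x ⬝ᵥ Matrix.mulVec (qInner q W (polyVal P) (polyVal P)) x) := by
  let L : CMat N →+ ℂ := AddMonoidHom.mk' (fun A => star x ⬝ᵥ Matrix.mulVec A x)
    (fun A B => by simp [Matrix.add_mulVec])
  have hL : Continuous L := by
    change Continuous fun A : CMat N => star x ⬝ᵥ Matrix.mulVec A x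
    fun_prop
  refine ((summable_qInnerTerm hm P P).hasSum.map L hL).congr_fun fun n => ?_
  simp only [L, Function.comp, AddMonoidHom.mk'_apply, qInnerTerm, Matrix.smul_mulVec,
    dotProduct_smul, smul_eq_mul]
  simp only [Matrix.star_mulVec, Matrix.conjTranspose_conjTranspose,
    Matrix.dotProduct_mulVec, Matrix.vecMul_vecMul, mul_assoc]

variable (hq0 : 0 < q) (hq1 : q < 1) (hW : ∀ n, (W n).PosDef)

include hq0 hq1 hW

/-- The quadratic form is a sum of nonnegative terms, one per lattice point. Either some `P(q^n)^*
x` is nonzero and contributes strictly, or all vanish and the infinite lattice forces every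
coefficient to be annihilated. -/
lemma qInner_self_nonneg_or (P : Polynomial (CMat N)) (x : Fin N → ℂ) :
    0 < star x ⬝ᵥ Matrix.mulVec (qInner q W (polyVal P) (polyVal P)) x ∨
      ∀ k, Matrix.vecMul (star x) (P.coeff k) = 0 := by
  have hs := hasSum_dotProduct_qInner_self hm P x
  have hq : ∀ n : ℕ, (0 : ℂ) < (q : ℂ) ^ n := fun n => by exact_mod_cast pow_pos hq0 n
  by_cases h : ∀ n : ℕ, Matrix.mulVec (polyVal P ((q : ℂ) ^ n)).conjTranspose x = 0
  · right
    refine vecMul_coeff_eq_zero P (star x) (infinite_range_pow hq0 hq1) ?_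
    rintro _ ⟨n, rfl⟩
    have := congrArg star (h n)
    rwa [Matrix.star_mulVec, Matrix.conjTranspose_conjTranspose, star_zero] at this
  · left
    push Not at h
    obtain ⟨n, hn⟩ := h
    have h1 := mul_pos (hq n) ((hW n).dotProduct_mulVec_pos hn)
    refine h1.trans_le (le_hasSum hs n fun j _ => ?_)
    exact mul_nonneg (hq j).le ((hW j).posSemidef.dotProduct_mulVec_nonneg _)

lemma posDef_qInner_self (P : Polynomial (CMat N)) (hP : IsUnit P.leadingCoeff) :
    (qInner q W (polyVal P) (polyVal P)).PosDef := by
  refine .of_dotProduct_mulVec_pos (qInner_conjTranspose (fun n => (hW n).isHermitian) _ _)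
    fun x hx => (qInner_self_nonneg_or hm hq0 hq1 hW P x).resolve_right fun h => hx ?_
  have h1 : star x = 0 :=
    Matrix.vecMul_injective_of_isUnit hP ((h _).trans (Matrix.zero_vecMul _).symm)
  simpa using h1

lemma eq_zero_of_qInner_self_eq_zero {P : Polynomial (CMat N)}
    (h : qInner q W (polyVal P) (polyVal P) = 0) : P = 0 := by
  ext k i j
  -- Testing against the `i`-th basis vector reads off row `i` of each coefficient.
  have h1 := (qInner_self_nonneg_or hm hq0 hq1 hW P (Pi.single i 1)).resolve_left
    (by simp [h]) k
  have h2 := congrFun h1 j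
  simpa [← Pi.single_star] using h2

/-! ### Monic orthogonal polynomials -/

omit hq0 hq1 hW in
-- Matrix coefficients on the second argument come out of the form on the right, so orthogonality to
-- the bare powers of `X` suffices.
lemma qInner_eq_zero_of_monomials {P : Polynomial (CMat N)} {n : ℕ}
    (h : ∀ i < n, qInner q W (polyVal P) (polyVal (Polynomial.X ^ i)) = 0)
    {Q : Polynomial (CMat N)} (hQ : Q.degree < n) :
    qInner q W (polyVal P) (polyVal Q) = 0 := by
  induction n generalizing Q with
  | zero =>
    have : Q = 0 := by simpa [Nat.WithBot.lt_zero_iff] using hQ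
    simp [this, qInner, qInnerTerm, polyVal_zero]
  | succ n ih =>
    have hQ' : Q = (Q - Polynomial.C (Q.coeff n) * Polynomial.X ^ n) +
        Polynomial.C (Q.coeff n) * Polynomial.X ^ n := by simp
    rw [hQ', qInner_add_right hm, qInner_C_mul_right hm, h n (by simp), zero_mul, add_zero]
    refine ih (fun i hi => h i (by omega)) ?_
    rw [Polynomial.degree_lt_iff_coeff_zero] at hQ ⊢
    intro m hnm
    rw [Polynomial.coeff_sub, Polynomial.coeff_C_mul, Polynomial.coeff_X_pow]
    rcases hnm.eq_or_lt with rfl | h'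
    · simp
    · simp [h'.ne', hQ m h']

/-- The lower coefficients solve a square linear system over `ℂ`. Its kernel consists of polynomials
of degree below `n` orthogonal to themselves, so the system is injective, hence solvable by finite
dimensionality. -/
lemma exists_monic_orthogonal [Nontrivial (CMat N)] (n : ℕ) :
    ∃ P : Polynomial (CMat N), P.Monic ∧ P.natDegree = n ∧
      ∀ Q : Polynomial (CMat N), Q.degree < n → qInner q W (polyVal P) (polyVal Q) = 0 := by
  let poly : (Fin n → CMat N) → Polynomial (CMat N) := fun c =>
    ∑ i : Fin n, Polynomial.C (c i) * Polynomial.X ^ (i : ℕ)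
  have hdeg : ∀ c, (poly c).degree < n := fun c => Polynomial.degree_sum_fin_lt c
  let T : (Fin n → CMat N) →ₗ[ℂ] (Fin n → CMat N) :=
    { toFun := fun c i => qInner q W (polyVal (poly c)) (polyVal (Polynomial.X ^ (i : ℕ)))
      map_add' := fun c d => by
        funext i
        have : poly (c + d) = poly c + poly d := by
          simp [poly, add_mul, Finset.sum_add_distrib]
        simp only [this, qInner_add_left hm, Pi.add_apply]
      map_smul' := fun z c => by
        funext i
        have : poly (z • c) = Polynomial.C (algebraMap ℂ (CMat N) z) * poly c := by
          simp only [poly, Finset.mul_sum, ← mul_assoc, ← Polynomial.C_mul, Pi.smul_apply]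
          simp only [Algebra.smul_def]
        simp only [this, qInner_C_mul_left hm, Pi.smul_apply, RingHom.id_apply]
        rw [← Algebra.smul_def] }
  have hinj : Function.Injective T := by
    rw [injective_iff_map_eq_zero]
    intro c hc
    have h0 : poly c = 0 := by
      refine eq_zero_of_qInner_self_eq_zero hm hq0 hq1 hW
        (qInner_eq_zero_of_monomials hm (fun i hi => ?_) (hdeg c))
      exact congrFun hc ⟨i, hi⟩
    funext i
    have h1 := congrArg (fun p => Polynomial.coeff p (i : ℕ)) h0
    simpa [poly, Polynomial.finsetSum_coeff, Polynomial.coeff_X_pow, Fin.val_inj] using h1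
  obtain ⟨c, hc⟩ := LinearMap.injective_iff_surjective.mp hinj
    (fun i => -qInner q W (polyVal (Polynomial.X ^ n)) (polyVal (Polynomial.X ^ (i : ℕ))))
  have hlt : (poly c).degree < (Polynomial.X ^ n : Polynomial (CMat N)).degree := by
    rw [Polynomial.degree_X_pow]; exact hdeg c
  refine ⟨Polynomial.X ^ n + poly c, (Polynomial.monic_X_pow n).add_of_left hlt, ?_,
    fun Q hQ => qInner_eq_zero_of_monomials hm (fun i hi => ?_) hQ⟩
  · rw [Polynomial.natDegree_add_eq_left_of_degree_lt hlt, Polynomial.natDegree_X_pow]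
  · have := congrFun hc ⟨i, hi⟩
    change qInner q W (polyVal (poly c)) (polyVal (Polynomial.X ^ i)) = _ at this
    rw [qInner_add_left hm, this, add_neg_cancel]

omit hq0 hq1 hW in
lemma IsMonicOrthogonalSeq.qInner_eq_zero {P : ℕ → Polynomial (CMat N)}
    (hP : IsMonicOrthogonalSeq q W P) {n : ℕ} {Q : Polynomial (CMat N)} (hQ : Q.degree < n) :
    qInner q W (polyVal (P n)) (polyVal Q) = 0 := by
  obtain ⟨Γ, -, hΓ⟩ := hP.1.orthogonal
  suffices ∀ d ≤ n, ∀ Q : Polynomial (CMat N), Q.degree < d →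
      qInner q W (polyVal (P n)) (polyVal Q) = 0 from this n le_rfl Q hQ
  intro d
  induction d with
  | zero =>
    intro _ Q hQ
    have : Q = 0 := by simpa [Nat.WithBot.lt_zero_iff] using hQ
    simp [this, qInner, qInnerTerm, polyVal_zero]
  | succ d ih =>
    intro hd Q hQ
    -- Since `P d` is monic, subtracting this multiple of it removes the coefficient of degree `d`.
    have hQ' : Q = (Q - Polynomial.C (Q.coeff d) * P d) + Polynomial.C (Q.coeff d) * P d := by
      simp
    rw [hQ', qInner_add_right hm, qInner_C_mul_right hm, hΓ, if_neg (by omega), zero_mul,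
      add_zero]
    refine ih (by omega) _ ?_
    rw [Polynomial.degree_lt_iff_coeff_zero] at hQ ⊢
    intro m hdm
    rw [Polynomial.coeff_sub, Polynomial.coeff_C_mul]
    rcases hdm.eq_or_lt with rfl | h'
    · have : (P d).coeff d = 1 := by
        have := (hP.2 d).coeff_natDegree
        rwa [hP.1.natDegree_eq] at this
      simp [this]
    · rw [Polynomial.coeff_eq_zero_of_natDegree_lt ((hP.1.natDegree_eq d).trans_lt h'),
        hQ m h']
      simp

theorem existsUnique_isMonicOrthogonalSeq [Nontrivial (CMat N)] :
    ∃! P : ℕ → Polynomial (CMat N), IsMonicOrthogonalSeq q W P := by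
  choose P hmon hdeg horth using exists_monic_orthogonal hm hq0 hq1 hW
  have hdeg' : ∀ n, (P n).degree = n := fun n => by
    rw [Polynomial.degree_eq_natDegree (hmon n).ne_zero, hdeg]
  have hunit : ∀ n, IsUnit (P n).leadingCoeff := fun n => by simp [(hmon n).leadingCoeff]
  refine ⟨P, ⟨⟨hdeg, hunit, fun n => qInner q W (polyVal (P n)) (polyVal (P n)),
    fun n => posDef_qInner_self hm hq0 hq1 hW _ (hunit n), fun m n => ?_⟩, hmon⟩,
    fun P' hP' => funext fun n => ?_⟩
  · split_ifs with h
    · rw [h]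
    · rcases lt_or_gt_of_ne h with h | h
      · rw [← qInner_conjTranspose (fun n => (hW n).isHermitian),
          horth n _ (by rw [hdeg']; exact_mod_cast h), Matrix.conjTranspose_zero]
      · exact horth m _ (by rw [hdeg']; exact_mod_cast h)
  · have hlt : (P' n - P n).degree < n := by
      rw [Polynomial.degree_lt_iff_coeff_zero]
      intro m hnm
      rw [Polynomial.coeff_sub]
      rcases hnm.eq_or_lt with rfl | h'
      · have h1 := (hP'.2 n).coeff_natDegree
        have h2 := (hmon n).coeff_natDegree
        rw [hP'.1.natDegree_eq] at h1
        rw [hdeg] at h2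
        rw [h1, h2, sub_self]
      · rw [Polynomial.coeff_eq_zero_of_natDegree_lt ((hP'.1.natDegree_eq n).trans_lt h'),
          Polynomial.coeff_eq_zero_of_natDegree_lt ((hdeg n).trans_lt h'), sub_self]
    -- The difference has degree below `n`, and both terms are orthogonal to such polynomials, so it
    -- is orthogonal to itself.
    refine sub_eq_zero.mp (eq_zero_of_qInner_self_eq_zero hm hq0 hq1 hW ?_)
    rw [qInner_sub_left hm, hP'.qInner_eq_zero hm hlt, horth n _ hlt, sub_self]

/-- A symmetric operator acting on polynomials without raising the degree, with
leading coefficients multiplied by `Λₙ`, has the monic orthogonal polynomials as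
eigenfunctions. -/
theorem IsMonicOrthogonalSeq.eigenfunction {P : ℕ → Polynomial (CMat N)}
    (hP : IsMonicOrthogonalSeq q W P) {D : (ℂ → CMat N) → (ℂ → CMat N)}
    (hsymm : ∀ P Q : Polynomial (CMat N),
      qInner q W (D (polyVal P)) (polyVal Q) = qInner q W (polyVal P) (D (polyVal Q)))
    {Λ : ℕ → CMat N}
    (hD : ∀ (n : ℕ) (Q : Polynomial (CMat N)), Q.natDegree ≤ n →
      ∃ R : Polynomial (CMat N), R.natDegree ≤ n ∧ R.coeff n = Q.coeff n * Λ n ∧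
        ∀ z : ℂ, z ≠ 0 → D (polyVal Q) z = polyVal R z)
    (n : ℕ) {z : ℂ} (hz : z ≠ 0) :
    D (polyVal (P n)) z = Λ n * polyVal (P n) z := by
  have hqn : ∀ n : ℕ, (q : ℂ) ^ n ≠ 0 := fun n => pow_ne_zero _ (by exact_mod_cast hq0.ne')
  obtain ⟨R, hRdeg, hRn, hR⟩ := hD n (P n) (hP.1.natDegree_eq n).le
  have hcoeff : (P n).coeff n = 1 := by
    have := (hP.2 n).coeff_natDegree
    rwa [hP.1.natDegree_eq] at this
  set S := R - Polynomial.C (Λ n) * P n with hS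
  have hSdeg : S.degree < n := by
    rw [Polynomial.degree_lt_iff_coeff_zero]
    intro m hnm
    rw [hS, Polynomial.coeff_sub, Polynomial.coeff_C_mul]
    rcases hnm.eq_or_lt with rfl | h'
    · rw [hRn, hcoeff, one_mul, mul_one, sub_self]
    · rw [Polynomial.coeff_eq_zero_of_natDegree_lt (hRdeg.trans_lt h'),
        Polynomial.coeff_eq_zero_of_natDegree_lt ((hP.1.natDegree_eq n).trans_lt h'),
        mul_zero, sub_self]
  have hS0 : S = 0 := by
    refine eq_zero_of_qInner_self_eq_zero hm hq0 hq1 hW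
      (qInner_eq_zero_of_monomials hm (fun i hi => ?_) hSdeg)
    obtain ⟨U, hUdeg, -, hU⟩ := hD i (Polynomial.X ^ i) (Polynomial.natDegree_X_pow_le i)
    -- Symmetry moves `D` onto `X ^ i`, whose image still has degree at most `i < n`.
    have hRi : qInner q W (polyVal R) (polyVal (Polynomial.X ^ i)) = 0 := by
      rw [qInner_congr (fun m => (hR _ (hqn m)).symm) (fun m => rfl), hsymm,
        qInner_congr (fun m => rfl) (fun m => hU _ (hqn m))]
      exact hP.qInner_eq_zero hm ((Polynomial.degree_le_of_natDegree_le hUdeg).trans_lt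
        (by exact_mod_cast hi))
    rw [hS, qInner_sub_left hm, qInner_C_mul_left hm, hRi, hP.qInner_eq_zero hm
      ((Polynomial.degree_X_pow_le i).trans_lt (by exact_mod_cast hi)), mul_zero, sub_zero]
  rw [hR z hz, sub_eq_zero.mp hS0, polyVal_C_mul]

end Moments

end GeneralWeight

/-! ### The little q-Jacobi weight and its second-order q-difference operator. -/

namespace LittleQJacobi

open Filter Topology

variable {q a b : ℝ} {v : ℂ}

/-! ### The matrix `A` -/

lemma diagonal_fin_two (x y : ℂ) : Matrix.diagonal ![x, y] = !![x, 0; 0, y] := by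
  ext i j; fin_cases i <;> fin_cases j <;> rfl

/-- `M` is diagonalised, with eigenvalues `1` and `0`, by the unipotent matrix with off-diagonal
entry `-v`. -/
theorem exp_log_smul_matM (hq0 : 0 < q) :
    NormedSpace.exp ((Real.log q : ℂ) • matM v) = matA q v := by
  have hU : IsUnit (!![1, -v; 0, 1] : CMat 2) := by
    rw [Matrix.isUnit_iff_isUnit_det]; simp [Matrix.det_fin_two]
  have hinv : (!![1, -v; 0, 1] : CMat 2)⁻¹ = !![1, v; 0, 1] := by
    refine Matrix.inv_eq_right_inv ?_
    ext i j; fin_cases i <;> fin_cases j <;> simp [Matrix.mul_apply, Fin.sum_univ_two]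
  have h1 : (Real.log q : ℂ) • matM v =
      !![1, -v; 0, 1] * Matrix.diagonal ![(Real.log q : ℂ), 0] * (!![1, -v; 0, 1] : CMat 2)⁻¹ := by
    rw [hinv, matM, diagonal_fin_two]
    ext i j; fin_cases i <;> fin_cases j <;>
      simp [Matrix.mul_apply, Fin.sum_univ_two]
  have hexp : NormedSpace.exp (Real.log q : ℂ) = q := by
    rw [← Complex.exp_eq_exp_ℂ, ← Complex.ofReal_exp, Real.exp_log hq0]
  have hexp2 : NormedSpace.exp ![(Real.log q : ℂ), 0] = ![(q : ℂ), 1] := by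
    funext i
    rw [Pi.coe_exp]
    fin_cases i
    · exact hexp
    · exact NormedSpace.exp_zero
  rw [h1, Matrix.exp_conj _ _ hU, Matrix.exp_diagonal, hexp2, diagonal_fin_two, hinv, matA]
  ext i j; fin_cases i <;> fin_cases j <;>
    simp [Matrix.mul_apply, Fin.sum_univ_two]
  ring

lemma matA_pow (n : ℕ) : matA q v ^ n = !![(q : ℂ) ^ n, -v * (1 - (q : ℂ) ^ n); 0, 1] := by
  induction n with
  | zero => ext i j; fin_cases i <;> fin_cases j <;> simp
  | succ n ih =>
    rw [pow_succ, ih, matA]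
    ext i j; fin_cases i <;> fin_cases j <;>
      simp [Matrix.mul_apply, Fin.sum_univ_two]
    all_goals ring

/-- `M` is idempotent, so `q^(nM) = (1 - M) + q^n M`. Thus `A^n` converges, with increments of order
`q^n`. -/
lemma matA_pow_eq (n : ℕ) : matA q v ^ n = 1 - (1 - (q : ℂ) ^ n) • matM v := by
  rw [matA_pow, matM]
  ext i j; fin_cases i <;> fin_cases j <;> simp <;> ring

lemma matA_pow_succ_eq (n : ℕ) :
    matA q v ^ (n + 1) = matA q v ^ n - ((q : ℂ) ^ n * (1 - q)) • matM v := by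
  rw [matA_pow_eq, matA_pow_eq, pow_succ]
  module

lemma isUnit_det_matA (hq0 : 0 < q) : IsUnit (matA q v).det := by
  simp [matA, Matrix.det_fin_two, hq0.ne']

lemma matA_inv (hq0 : 0 < q) :
    (matA q v)⁻¹ = !![(q : ℂ)⁻¹, v * (1 - q) * (q : ℂ)⁻¹; 0, 1] := by
  have hq : (q : ℂ) ≠ 0 := by exact_mod_cast hq0.ne'
  refine Matrix.inv_eq_right_inv ?_
  rw [matA]
  ext i j; fin_cases i <;> fin_cases j <;> simp [Matrix.mul_apply, Fin.sum_univ_two, hq]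
  field_simp
  ring

lemma tendsto_ofReal_pow (hq0 : 0 < q) (hq1 : q < 1) :
    Tendsto (fun n : ℕ => (q : ℂ) ^ n) atTop (𝓝 0) :=
  tendsto_pow_atTop_nhds_zero_of_norm_lt_one (by simpa [abs_of_pos hq0] using hq1)

lemma tendsto_matA_pow (hq0 : 0 < q) (hq1 : q < 1) :
    Tendsto (fun n => matA q v ^ n) atTop (𝓝 (1 - matM v)) := by
  simp only [matA_pow_eq]
  simpa using ((((tendsto_ofReal_pow hq0 hq1).const_sub 1).smul_const (matM v)).const_sub 1)

lemma tendsto_conjTranspose {F : ℕ → CMat 2} {L : CMat 2} (h : Tendsto F atTop (𝓝 L)) :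
    Tendsto (fun n => (F n).conjTranspose) atTop (𝓝 L.conjTranspose) :=
  (continuous_id.matrix_conjTranspose.tendsto L).comp h

/-! ### The weight -/

/-- The scalar factor `aⁿ (bq;q)ₙ / (q;q)ₙ` of the weight. -/
def scalarWeight (q a b : ℝ) (n : ℕ) : ℝ := a ^ n * (qPoch (b * q) q n / qPoch q q n)

lemma weight_eq (n : ℕ) : weight q a b v n =
    (scalarWeight q a b n : ℂ) • (matA q v ^ n * (matA q v ^ n).conjTranspose) := by
  rw [weight, scalarWeight, Matrix.conjTranspose_pow]

lemma qPoch_pos {c : ℝ} (hq0 : 0 < q) (hq1 : q < 1) (hc : c < 1) (n : ℕ) : 0 < qPoch c q n := by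
  induction n with
  | zero => exact one_pos
  | succ n ih =>
    refine mul_pos ?_ ih
    have h0 := pow_pos hq0 n
    have h1 := pow_le_one₀ hq0.le hq1.le (n := n)
    rcases le_total c 0 with h | h <;> nlinarith

lemma scalarWeight_pos (hq0 : 0 < q) (hq1 : q < 1) (ha0 : 0 < a) (hb : b < q⁻¹) (n : ℕ) :
    0 < scalarWeight q a b n := by
  have hbq : b * q < 1 := by rwa [← lt_div_iff₀ hq0, one_div]
  exact mul_pos (pow_pos ha0 n) (div_pos (qPoch_pos hq0 hq1 hbq n) (qPoch_pos hq0 hq1 hq1 n))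

lemma one_sub_pow_pos (hq0 : 0 < q) (hq1 : q < 1) (n : ℕ) : 0 < 1 - q ^ (n + 1) :=
  sub_pos.mpr (pow_lt_one₀ hq0.le hq1 (by omega))

lemma scalarWeight_succ (hq0 : 0 < q) (hq1 : q < 1) (n : ℕ) :
    scalarWeight q a b (n + 1) * (1 - q ^ (n + 1)) =
      a * (1 - b * q ^ (n + 1)) * scalarWeight q a b n := by
  have h1 := (qPoch_pos hq0 hq1 hq1 n).ne'
  have h2 := (one_sub_pow_pos hq0 hq1 n).ne'
  have h3 : 1 - q * q ^ n ≠ 0 := by rwa [← pow_succ']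
  simp only [scalarWeight, qPoch, pow_succ'] at h2 ⊢
  field_simp

lemma tendsto_real_pow_succ (hq0 : 0 < q) (hq1 : q < 1) :
    Tendsto (fun n : ℕ => q ^ (n + 1)) atTop (𝓝 0) :=
  (tendsto_pow_atTop_nhds_zero_of_lt_one hq0.le hq1).comp (tendsto_add_atTop_nat 1)

/-- Ratio test: the quotients tend to `a q`, which is below `1` exactly because `a < q⁻¹`. -/
lemma summable_scalarWeight (hq0 : 0 < q) (hq1 : q < 1) (ha0 : 0 < a) (ha : a < q⁻¹)
    (hb : b < q⁻¹) : Summable fun n => q ^ n * scalarWeight q a b n := by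
  have haq : a * q < 1 := by rwa [← lt_div_iff₀ hq0, one_div]
  have hpos : ∀ n, 0 < q ^ n * scalarWeight q a b n := fun n =>
    mul_pos (pow_pos hq0 n) (scalarWeight_pos hq0 hq1 ha0 hb n)
  refine summable_of_ratio_test_tendsto_lt_one haq (.of_forall fun n => (hpos n).ne') ?_
  have hlim : Tendsto (fun n : ℕ => a * q * (1 - b * q ^ (n + 1)) / (1 - q ^ (n + 1))) atTop
      (𝓝 (a * q * (1 - b * 0) / (1 - 0))) :=
    ((((tendsto_real_pow_succ hq0 hq1).const_mul b).const_sub 1).const_mul (a * q)).div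
      ((tendsto_real_pow_succ hq0 hq1).const_sub 1) (by simp)
  simp only [mul_zero, sub_zero, mul_one, div_one] at hlim
  refine hlim.congr fun n => ?_
  rw [Real.norm_of_nonneg (hpos _).le, Real.norm_of_nonneg (hpos _).le,
    div_eq_div_iff (one_sub_pow_pos hq0 hq1 n).ne' (hpos n).ne']
  linear_combination (-q ^ (n + 1)) * scalarWeight_succ (a := a) (b := b) hq0 hq1 n

lemma summable_smul_of_tendsto {s : ℕ → ℝ} (hs : Summable s) (hs0 : ∀ n, 0 ≤ s n)
    {F : ℕ → CMat 2} {L : CMat 2} (hF : Tendsto F atTop (𝓝 L)) :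
    Summable fun n => (s n : ℂ) • F n := by
  refine Pi.summable.mpr fun i => Pi.summable.mpr fun j => ?_
  have hFij : Tendsto (fun n => F n i j) atTop (𝓝 (L i j)) :=
    tendsto_pi_nhds.mp (tendsto_pi_nhds.mp hF i) j
  have h1 : (fun n => (s n : ℂ) * F n i j) =O[atTop] fun n => s n * 1 :=
    (Asymptotics.IsBigO.of_norm_le fun n => by simp [abs_of_nonneg (hs0 n)]).mul
      (hFij.isBigO_one ℝ)
  simpa using summable_of_isBigO_nat (by simpa using hs) h1

theorem posDef_weight (hq0 : 0 < q) (hq1 : q < 1) (ha0 : 0 < a) (hb : b < q⁻¹) (n : ℕ) :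
    (weight q a b v n).PosDef := by
  rw [weight_eq]
  refine Matrix.PosDef.smul (Matrix.PosDef.mul_conjTranspose_self _ ?_)
    (by exact_mod_cast scalarWeight_pos hq0 hq1 ha0 hb n)
  exact Matrix.vecMul_injective_of_isUnit
    (((Matrix.isUnit_iff_isUnit_det _).mpr (isUnit_det_matA hq0)).pow n)

theorem summable_moments (hq0 : 0 < q) (hq1 : q < 1) (ha0 : 0 < a) (ha : a < q⁻¹)
    (hb : b < q⁻¹) (k : ℕ) :
    Summable fun n : ℕ => ((q : ℂ) ^ n * ((q : ℂ) ^ n) ^ k) • weight q a b v n := by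
  have hA := tendsto_matA_pow (v := v) hq0 hq1
  refine (summable_smul_of_tendsto (summable_scalarWeight hq0 hq1 ha0 ha hb)
    (fun n => (mul_pos (pow_pos hq0 n) (scalarWeight_pos hq0 hq1 ha0 hb n)).le)
    (((tendsto_ofReal_pow hq0 hq1).pow k).smul (hA.mul (tendsto_conjTranspose hA)))).congr
    fun n => ?_
  rw [weight_eq, smul_smul, smul_smul]
  push_cast
  congr 1
  ring

theorem isQWeight_weight (hq0 : 0 < q) (hq1 : q < 1) (ha0 : 0 < a) (ha : a < q⁻¹)
    (hb : b < q⁻¹) : IsQWeight q (weight q a b v) where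
  posDef := posDef_weight hq0 hq1 ha0 hb
  moments := summable_moments hq0 hq1 ha0 ha hb
  nonsingular P hP := (posDef_qInner_self (summable_moments hq0 hq1 ha0 ha hb) hq0 hq1
    (posDef_weight hq0 hq1 ha0 hb) P hP).isUnit

/-! ### The action of the operator on polynomials -/

lemma opD_add (P Q : Polynomial (CMat 2)) (z : ℂ) :
    opD q a b v (polyVal (P + Q)) z = opD q a b v (polyVal P) z + opD q a b v (polyVal Q) z := by
  simp only [opD, qDiffOp, qShift, polyVal_add, add_mul]
  abel

/-- This is the `z`-free part of the coefficients of `D`, with the shifts of `z^n` supplying the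
factors `q^(-n)` and `q^n`. -/
lemma eigenvalue_eq (hq0 : 0 < q) (n : ℕ) : eigenvalue q a b v n =
    matK q a v - ((q : ℂ) ^ n)⁻¹ • (matA q v)⁻¹ - ((a : ℂ) * b * (q : ℂ) ^ (n + 1)) • matA q v := by
  have hq : (q : ℂ) ≠ 0 := by exact_mod_cast hq0.ne'
  rw [matA_inv hq0, matA, matK, eigenvalue, zpow_sub₀ hq, zpow_sub₀ hq]
  ext i j; fin_cases i <;> fin_cases j <;> simp <;> field_simp <;> ring

lemma opD_monomial (hq0 : 0 < q) (k : ℕ) (c : CMat 2) {z : ℂ} (hz : z ≠ 0) :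
    opD q a b v (polyVal (Polynomial.monomial k c)) z =
      polyVal (Polynomial.monomial k (c * eigenvalue q a b v k) + Polynomial.monomial (k - 1)
        (c * ((((q : ℂ) ^ k)⁻¹ - 1) • (matA q v)⁻¹ + (((q : ℂ) ^ k - 1) * a) • matA q v))) z := by
  have hq : (q : ℂ) ≠ 0 := by exact_mod_cast hq0.ne'
  simp only [opD, qDiffOp, qShift, coeffNegOne, coeffZero, coeffOne, polyVal_add,
    polyVal_monomial, eigenvalue_eq hq0, zpow_neg, zpow_one, zpow_zero, one_mul]
  -- The remaining identity is linear in `A⁻¹`, `A` and `K`, so their entries no longer matter.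
  generalize (matA q v)⁻¹ = B
  generalize matA q v = A
  generalize matK q a v = K
  simp only [mul_sub, mul_add, mul_smul_comm, smul_mul_assoc, smul_add, smul_sub, smul_smul]
  cases k with
  -- Here `k - 1` truncates to `0`, harmlessly: the lower coefficient carries the factors `q^(-k) -
  -- 1` and `q^k - 1`, which vanish, so no pole at `0` appears.
  | zero => match_scalars <;> simp <;> ring
  | succ k =>
    simp only [Nat.add_sub_cancel, mul_pow, inv_pow]
    match_scalars <;> field_simp <;> ring

theorem exists_opD_eq_polyVal (hq0 : 0 < q) (n : ℕ) (P : Polynomial (CMat 2))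
    (hP : P.natDegree ≤ n) : ∃ R : Polynomial (CMat 2), R.natDegree ≤ n ∧
      R.coeff n = P.coeff n * eigenvalue q a b v n ∧
      ∀ z : ℂ, z ≠ 0 → opD q a b v (polyVal P) z = polyVal R z := by
  refine Polynomial.induction_with_natDegree_le (fun P => ∃ R : Polynomial (CMat 2),
    R.natDegree ≤ n ∧ R.coeff n = P.coeff n * eigenvalue q a b v n ∧
      ∀ z : ℂ, z ≠ 0 → opD q a b v (polyVal P) z = polyVal R z) n ?_ ?_ ?_ P hP
  · exact ⟨0, by simp, by simp, fun z _ => by simp [opD, qDiffOp, qShift, polyVal_zero]⟩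
  · intro k c _ hk
    rw [Polynomial.C_mul_X_pow_eq_monomial]
    refine ⟨_, ?_, ?_, fun z hz => opD_monomial hq0 k c hz⟩
    · exact Polynomial.natDegree_add_le_of_degree_le
        ((Polynomial.natDegree_monomial_le _).trans hk)
        ((Polynomial.natDegree_monomial_le _).trans (by omega))
    · rw [Polynomial.coeff_add, Polynomial.coeff_monomial, Polynomial.coeff_monomial,
        Polynomial.coeff_monomial]
      rcases Nat.eq_zero_or_pos k with rfl | hk0
      · by_cases h : 0 = n
        · subst h; simp
        · simp [h]
      · rw [if_neg (show k - 1 ≠ n by omega), add_zero]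
        split_ifs with h
        · rw [h]
        · rw [zero_mul]
  · rintro f g - - ⟨R, hR1, hR2, hR3⟩ ⟨S, hS1, hS2, hS3⟩
    refine ⟨R + S, Polynomial.natDegree_add_le_of_degree_le hR1 hS1, ?_, fun z hz => ?_⟩
    · rw [Polynomial.coeff_add, hR2, hS2, Polynomial.coeff_add, add_mul]
    · rw [opD_add, hR3 z hz, hS3 z hz, polyVal_add]

/-! ### Symmetry -/

/-- The scalar factor of `qⁿ F₁(qⁿ) W(qⁿ)`. -/
def boundaryCoeff (q a b : ℝ) (n : ℕ) : ℝ := a * (1 - b * q ^ (n + 1)) * scalarWeight q a b n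

/-- The factor `q^(n+1) (q^(-(n+1)) - 1) = 1 - q^(n+1)` is what the recurrence of the scalar weight
absorbs, and `A⁻¹` lowers the left power of `A`. The result is the adjoint of the expression in
`smul_coeffOne_mul_weight`. -/
lemma smul_coeffNegOne_mul_weight (hq0 : 0 < q) (hq1 : q < 1) (n : ℕ) :
    (q : ℂ) ^ (n + 1) • (coeffNegOne q v ((q : ℂ) ^ (n + 1)) * weight q a b v (n + 1)) =
      (boundaryCoeff q a b n : ℂ) •
        (matA q v ^ n * (matA q v ^ (n + 1)).conjTranspose) := by
  have hq : (q : ℂ) ≠ 0 := by exact_mod_cast hq0.ne'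
  rw [boundaryCoeff, ← scalarWeight_succ hq0 hq1, coeffNegOne, weight_eq, smul_mul_assoc,
    mul_smul_comm, pow_succ' (matA q v) n, mul_assoc (matA q v),
    Matrix.nonsing_inv_mul_cancel_left _ _ (isUnit_det_matA hq0), smul_smul, smul_smul]
  congr 1
  push_cast
  field_simp

lemma smul_coeffOne_mul_weight (hq0 : 0 < q) (n : ℕ) :
    (q : ℂ) ^ n • (coeffOne q a b v ((q : ℂ) ^ n) * weight q a b v n) =
      (boundaryCoeff q a b n : ℂ) •
        (matA q v ^ (n + 1) * (matA q v ^ n).conjTranspose) := by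
  have hq : (q : ℂ) ≠ 0 := by exact_mod_cast hq0.ne'
  rw [boundaryCoeff, coeffOne, weight_eq, smul_mul_assoc,
    mul_smul_comm, pow_succ' (matA q v) n, mul_assoc (matA q v), smul_smul, smul_smul]
  congr 1
  push_cast
  field_simp
  ring

/-- Conjugation by `A^n` fixes `A⁻¹ + aA` and scales `K` by `q^(-n)`, the same factor as `z⁻¹`. What
remains is `K - A⁻¹ - aA`, and `K` is chosen to cancel its off-diagonal entry; the real diagonal
left over gives the Hermitian property below. -/
lemma coeffZero_mul_matA_pow (hq0 : 0 < q) (n : ℕ) :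
    coeffZero q a v ((q : ℂ) ^ n) * matA q v ^ n = ((q : ℂ) ^ n)⁻¹ • (matA q v ^ n *
      Matrix.diagonal ![-((q : ℂ)⁻¹ + a * q), -(1 + (a : ℂ))]) := by
  have hq : (q : ℂ) ≠ 0 := by exact_mod_cast hq0.ne'
  rw [coeffZero, matA_inv hq0, matA_pow, matA, matK, diagonal_fin_two]
  ext i j; fin_cases i <;> fin_cases j <;>
    simp [Matrix.mul_apply, Fin.sum_univ_two] <;> field_simp <;> ring

lemma isHermitian_coeffZero_mul_weight (hq0 : 0 < q) (n : ℕ) :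
    ((q : ℂ) ^ n • (coeffZero q a v ((q : ℂ) ^ n) * weight q a b v n)).IsHermitian := by
  have hq : (q : ℂ) ≠ 0 := by exact_mod_cast hq0.ne'
  have hD : (Matrix.diagonal ![-((q : ℂ)⁻¹ + a * q), -(1 + (a : ℂ))]).conjTranspose =
      Matrix.diagonal ![-((q : ℂ)⁻¹ + a * q), -(1 + (a : ℂ))] := by
    rw [Matrix.diagonal_conjTranspose]
    congr 1
    ext i; fin_cases i <;> simp
  rw [weight_eq, mul_smul_comm, ← mul_assoc, coeffZero_mul_matA_pow hq0, smul_mul_assoc,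
    smul_smul, smul_smul, Matrix.IsHermitian, Matrix.conjTranspose_smul,
    Matrix.conjTranspose_mul, Matrix.conjTranspose_mul, Matrix.conjTranspose_conjTranspose, hD,
    ← mul_assoc]
  congr 1
  simp

/-- The boundary term in the summation by parts for `⟨D f, g⟩ - ⟨f, D g⟩`. -/
def boundaryTerm (q a b : ℝ) (v : ℂ) (f g : ℂ → CMat 2) (n : ℕ) : CMat 2 :=
  (boundaryCoeff q a b n : ℂ) •
    (f ((q : ℂ) ^ (n + 1)) * (matA q v ^ (n + 1) * (matA q v ^ n).conjTranspose) *
        (g ((q : ℂ) ^ n)).conjTranspose -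
      f ((q : ℂ) ^ n) * (matA q v ^ n * (matA q v ^ (n + 1)).conjTranspose) *
        (g ((q : ℂ) ^ (n + 1))).conjTranspose)

/-- `F_{-1}` vanishes at `z = 1`, so the value at `q⁻¹`, off the lattice, drops out and there is no
lower boundary term. -/
lemma smul_opD_mul_weight_zero (hq0 : 0 < q) (f : ℂ → CMat 2) :
    (q : ℂ) ^ 0 • (opD q a b v f ((q : ℂ) ^ 0) * weight q a b v 0) =
      f ((q : ℂ) ^ 0) * ((q : ℂ) ^ 0 • (coeffZero q a v ((q : ℂ) ^ 0) * weight q a b v 0)) +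
      (boundaryCoeff q a b 0 : ℂ) •
        (f ((q : ℂ) ^ 1) * (matA q v ^ 1 * (matA q v ^ 0).conjTranspose)) := by
  rw [← mul_smul_comm (boundaryCoeff q a b 0 : ℂ), ← smul_coeffOne_mul_weight hq0]
  simp [opD, qDiffOp, qShift, coeffNegOne, add_mul, mul_assoc]

lemma smul_opD_mul_weight_succ (hq0 : 0 < q) (hq1 : q < 1) (f : ℂ → CMat 2) (n : ℕ) :
    (q : ℂ) ^ (n + 1) • (opD q a b v f ((q : ℂ) ^ (n + 1)) * weight q a b v (n + 1)) =
      (boundaryCoeff q a b n : ℂ) •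
        (f ((q : ℂ) ^ n) * (matA q v ^ n * (matA q v ^ (n + 1)).conjTranspose)) +
      f ((q : ℂ) ^ (n + 1)) * ((q : ℂ) ^ (n + 1) •
        (coeffZero q a v ((q : ℂ) ^ (n + 1)) * weight q a b v (n + 1))) +
      (boundaryCoeff q a b (n + 1) : ℂ) •
        (f ((q : ℂ) ^ (n + 2)) *
          (matA q v ^ (n + 2) * (matA q v ^ (n + 1)).conjTranspose)) := by
  have hq : (q : ℂ) ≠ 0 := by exact_mod_cast hq0.ne'
  have h1 : (q : ℂ) ^ (-1 : ℤ) * (q : ℂ) ^ (n + 1) = (q : ℂ) ^ n := by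
    rw [zpow_neg_one, pow_succ']; field_simp
  have h2 : (q : ℂ) ^ (1 : ℤ) * (q : ℂ) ^ (n + 1) = (q : ℂ) ^ (n + 2) := by
    rw [zpow_one, ← pow_succ']
  rw [← mul_smul_comm (boundaryCoeff q a b n : ℂ), ← smul_coeffNegOne_mul_weight hq0 hq1,
    ← mul_smul_comm (boundaryCoeff q a b (n + 1) : ℂ), ← smul_coeffOne_mul_weight hq0]
  simp only [opD, qDiffOp, qShift, h1, h2, zpow_zero, one_mul, add_mul, mul_assoc, smul_add,
    mul_smul_comm]

/-- Summation by parts: the Hermitian `F_0` contributions cancel, and the `F_{-1}` contributions at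
`n + 1` cancel the boundary term left at `n`. -/
lemma sum_qInnerTerm_opD_sub (hq0 : 0 < q) (hq1 : q < 1)
    (hW : ∀ n, (weight q a b v n).IsHermitian) (f g : ℂ → CMat 2) (n : ℕ) :
    ∑ k ∈ Finset.range (n + 1), (qInnerTerm q (weight q a b v) (opD q a b v f) g k -
      qInnerTerm q (weight q a b v) f (opD q a b v g) k) = boundaryTerm q a b v f g n := by
  have hterm : ∀ (f g : ℂ → CMat 2) (k : ℕ),
      qInnerTerm q (weight q a b v) (opD q a b v f) g k =
      ((q : ℂ) ^ k • (opD q a b v f ((q : ℂ) ^ k) * weight q a b v k)) *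
        (g ((q : ℂ) ^ k)).conjTranspose := fun f g k => by
    rw [qInnerTerm, smul_mul_assoc]
  have hterm' : ∀ k, qInnerTerm q (weight q a b v) f (opD q a b v g) k =
      f ((q : ℂ) ^ k) *
      ((q : ℂ) ^ k • (opD q a b v g ((q : ℂ) ^ k) * weight q a b v k)).conjTranspose := fun k => by
    rw [← qInnerTerm_conjTranspose hW, hterm, Matrix.conjTranspose_mul,
      Matrix.conjTranspose_conjTranspose]
  have hH := fun k => (isHermitian_coeffZero_mul_weight (a := a) (b := b) (v := v) hq0 k).eq
  have hc : ∀ r : ℝ, star (r : ℂ) = r := Complex.conj_ofReal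
  induction n with
  | zero =>
    rw [Finset.sum_range_one, hterm, hterm', smul_opD_mul_weight_zero hq0,
      smul_opD_mul_weight_zero hq0, Matrix.conjTranspose_add, Matrix.conjTranspose_mul, hH,
      boundaryTerm]
    simp only [Matrix.conjTranspose_smul, hc, Matrix.conjTranspose_mul,
      Matrix.conjTranspose_conjTranspose, add_mul, mul_add, smul_mul_assoc, mul_smul_comm,
      mul_assoc, smul_sub, zero_add]
    abel
  | succ n ih =>
    rw [Finset.sum_range_succ, ih, hterm, hterm', smul_opD_mul_weight_succ hq0 hq1,
      smul_opD_mul_weight_succ hq0 hq1, Matrix.conjTranspose_add, Matrix.conjTranspose_add,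
      Matrix.conjTranspose_mul (g _), hH, boundaryTerm, boundaryTerm]
    simp only [Matrix.conjTranspose_smul, hc, Matrix.conjTranspose_mul,
      Matrix.conjTranspose_conjTranspose, add_mul, mul_add, smul_mul_assoc, mul_smul_comm,
      mul_assoc, smul_sub, add_assoc, one_add_one_eq_two]
    abel

/-! ### Decay of the boundary term and conclusion of the symmetry. -/

lemma exists_polyVal_shift_sub (P : Polynomial (CMat 2)) : ∃ S : Polynomial (CMat 2),
    ∀ z : ℂ, polyVal P (z * q) = polyVal P z + z • polyVal S z := by
  induction P using Polynomial.induction_on' with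
  | add P Q hP hQ =>
    obtain ⟨S, hS⟩ := hP
    obtain ⟨T, hT⟩ := hQ
    refine ⟨S + T, fun z => ?_⟩
    rw [polyVal_add, polyVal_add, polyVal_add, hS, hT]
    module
  | monomial k c =>
    cases k with
    | zero => exact ⟨0, fun z => by rw [polyVal_monomial, polyVal_monomial]; simp [polyVal_zero]⟩
    | succ k =>
      refine ⟨Polynomial.monomial k (((q : ℂ) ^ (k + 1) - 1) • c), fun z => ?_⟩
      rw [polyVal_monomial, polyVal_monomial, polyVal_monomial]
      module

lemma tendsto_boundaryTerm (hq0 : 0 < q) (hq1 : q < 1) (ha0 : 0 < a) (ha : a < q⁻¹)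
    (hb : b < q⁻¹) (P Q : Polynomial (CMat 2)) :
    Tendsto (boundaryTerm q a b v (polyVal P) (polyVal Q)) atTop (𝓝 0) := by
  obtain ⟨S, hS⟩ := exists_polyVal_shift_sub (q := q) P
  obtain ⟨T, hT⟩ := exists_polyVal_shift_sub (q := q) Q
  have hq := tendsto_ofReal_pow hq0 hq1
  have hpoly : ∀ R : Polynomial (CMat 2),
      Tendsto (fun n : ℕ => polyVal R ((q : ℂ) ^ n)) atTop (𝓝 (polyVal R 0)) := fun R =>
    ((continuous_polyVal R).tendsto 0).comp hq
  have hA := tendsto_matA_pow (v := v) hq0 hq1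
  have hA1 := hA.comp (tendsto_add_atTop_nat 1)
  -- Only `q^n` times the scalar weight is known to tend to zero, so one factor `q^n` must come from
  -- the matrix bracket.
  have hc : Tendsto (fun n => ((boundaryCoeff q a b n * q ^ n : ℝ) : ℂ)) atTop (𝓝 0) := by
    have h1 := ((((tendsto_real_pow_succ hq0 hq1).const_mul b).const_sub 1).const_mul a).mul
      (summable_scalarWeight hq0 hq1 ha0 ha hb).tendsto_atTop_zero
    rw [mul_zero] at h1
    have h2 := (Complex.continuous_ofReal.tendsto 0).comp h1
    rw [Complex.ofReal_zero] at h2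
    refine h2.congr fun n => ?_
    simp only [Function.comp, boundaryCoeff]
    congr 1
    ring
  -- The bracket divided by `q^n`: the increments of `P` and of `Q`, then the commutator-like part
  -- `A^(n+1) (A^n)^* - A^n (A^(n+1))^*`, each convergent.
  have hG := hc.smul ((((hpoly S).mul (hA1.mul (tendsto_conjTranspose hA))).mul
      (tendsto_conjTranspose (hpoly Q))).sub
    (((hpoly P).mul (hA.mul (tendsto_conjTranspose hA1))).mul
      (tendsto_conjTranspose (hpoly T))) |>.add
    (((hpoly P).mul (((hA.mul_const (matM v).conjTranspose).sub
      ((tendsto_conjTranspose hA).const_mul (matM v))).const_smul (1 - (q : ℂ)))).mul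
      (tendsto_conjTranspose (hpoly Q))))
  rw [zero_smul] at hG
  refine hG.congr fun n => ?_
  have hstar : ∀ n : ℕ, star ((q : ℂ) ^ n) = (q : ℂ) ^ n := fun n => by
    simp
  have hstar1 : star ((q : ℂ) ^ n * (1 - q)) = (q : ℂ) ^ n * (1 - q) := by simp
  have hstar2 : ((matA q v ^ (n + 1)).conjTranspose) = (matA q v ^ n).conjTranspose -
      ((q : ℂ) ^ n * (1 - q)) • (matM v).conjTranspose := by
    rw [matA_pow_succ_eq, Matrix.conjTranspose_sub, Matrix.conjTranspose_smul, hstar1]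
  simp only [Function.comp, boundaryTerm]
  have hPn : polyVal P ((q : ℂ) ^ (n + 1)) =
      polyVal P ((q : ℂ) ^ n) + (q : ℂ) ^ n • polyVal S ((q : ℂ) ^ n) := by rw [pow_succ, hS]
  have hQn : polyVal Q ((q : ℂ) ^ (n + 1)) =
      polyVal Q ((q : ℂ) ^ n) + (q : ℂ) ^ n • polyVal T ((q : ℂ) ^ n) := by rw [pow_succ, hT]
  rw [hPn, hQn, hstar2, matA_pow_succ_eq]
  simp only [Matrix.conjTranspose_add, Matrix.conjTranspose_smul, hstar,
    mul_add, add_mul, mul_sub, sub_mul, smul_mul_assoc, mul_smul_comm, mul_assoc,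
    smul_add, smul_sub, smul_smul]
  push_cast
  module

theorem isSymmetricOp_opD (hq0 : 0 < q) (hq1 : q < 1) (ha0 : 0 < a) (ha : a < q⁻¹)
    (hb : b < q⁻¹) : IsSymmetricOp q (weight q a b v) (opD q a b v) where
  preserves P := by
    obtain ⟨R, -, -, hR⟩ := exists_opD_eq_polyVal hq0 P.natDegree P le_rfl
    exact ⟨R, hR⟩
  symm P Q := by
    have hqn : ∀ n : ℕ, (q : ℂ) ^ n ≠ 0 := fun n => pow_ne_zero _ (by exact_mod_cast hq0.ne')
    have hm := summable_moments (v := v) hq0 hq1 ha0 ha hb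
    obtain ⟨R, -, -, hR⟩ :=
      exists_opD_eq_polyVal (a := a) (b := b) (v := v) hq0 P.natDegree P le_rfl
    obtain ⟨S, -, -, hS⟩ :=
      exists_opD_eq_polyVal (a := a) (b := b) (v := v) hq0 Q.natDegree Q le_rfl
    have h1 : Summable (qInnerTerm q (weight q a b v) (opD q a b v (polyVal P)) (polyVal Q)) :=
      (summable_qInnerTerm hm R Q).congr fun n => by simp only [qInnerTerm, hR _ (hqn n)]
    have h2 : Summable (qInnerTerm q (weight q a b v) (polyVal P) (opD q a b v (polyVal Q))) :=
      (summable_qInnerTerm hm P S).congr fun n => by simp only [qInnerTerm, hS _ (hqn n)]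
    rw [← sub_eq_zero, qInner, qInner, ← h1.tsum_sub h2]
    -- The partial sums over `range (n + 1)` converge to the full difference and also equal the
    -- boundary term, which tends to zero.
    refine tendsto_nhds_unique
      ((h1.sub h2).hasSum.tendsto_sum_nat.comp (tendsto_add_atTop_nat 1))
      ((tendsto_boundaryTerm (v := v) hq0 hq1 ha0 ha hb P Q).congr fun n => ?_)
    exact (sum_qInnerTerm_opD_sub hq0 hq1
      (fun n => (posDef_weight hq0 hq1 ha0 hb n).isHermitian) _ _ n).symm

end LittleQJacobi

end

theorem mainTheorem1 (q a b : ℝ) (v : ℂ) (hq0 : 0 < q) (hq1 : q < 1)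
    (ha0 : 0 < a) (ha : a < q⁻¹) (hb : b < q⁻¹) :
    NormedSpace.exp ((Real.log q : ℂ) • LittleQJacobi.matM v) = LittleQJacobi.matA q v ∧
    IsQWeight q (LittleQJacobi.weight q a b v) ∧
    IsSymmetricOp q (LittleQJacobi.weight q a b v) (LittleQJacobi.opD q a b v) ∧
    (∃! P : ℕ → Polynomial (CMat 2),
      IsMonicOrthogonalSeq q (LittleQJacobi.weight q a b v) P) ∧
    ∀ P : ℕ → Polynomial (CMat 2),
      IsMonicOrthogonalSeq q (LittleQJacobi.weight q a b v) P →
      ∀ (n : ℕ) (z : ℂ), z ≠ 0 →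
        LittleQJacobi.opD q a b v (polyVal (P n)) z =
          LittleQJacobi.eigenvalue q a b v n * polyVal (P n) z := by
  have hw := LittleQJacobi.isQWeight_weight (v := v) hq0 hq1 ha0 ha hb
  have hs := LittleQJacobi.isSymmetricOp_opD (v := v) hq0 hq1 ha0 ha hb
  exact ⟨LittleQJacobi.exp_log_smul_matM hq0, hw, hs,
    existsUnique_isMonicOrthogonalSeq hw.moments hq0 hq1 hw.posDef,
    fun P hP n z hz => hP.eigenfunction hw.moments hq0 hq1 hw.posDef hs.symm
      (LittleQJacobi.exists_opD_eq_polyVal hq0) n hz⟩
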